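/- For $f \in L_2(\mathbb{R}^3)$ (complex-valued) and $t \in \mathbb{R}$ let $B_t f = u(t,\cdot)$, where $u$ is the solution of the wave equation $\partial_t^2 u = \Delta u$ on $\mathbb{R}\times\mathbb{R}^3$ with $u(0,\cdot) = 0$ and $\partial_t u(0,\cdot) = f$; that is, $B_t f$ is the element of $L_2(\mathbb{R}^3)$ with $$\widehat{B_t f}(\zeta) = \frac{\sin(t|\zeta|)}{|\zeta|}\,\hat f(\zeta), \qquad \hat f(\zeta) = \int_{\mathbb{R}^3} e^{-i x\cdot\zeta} f(x)\,dx .$$ For $g \in L_1(\mathbb{R}^3)$ let $$Mg(x) = \sup_{s>0}\left|\int_{\mathbb{R}^3} \frac{1}{(4\pi s)^{3/2}}\, e^{-|y|^2/(4s)}\, g(x-y)\,dy\right|$$ be its heat maximal function, let $H_1(\mathbb{R}^3)$ be the space of all $g \in L_1(\mathbb{R}^3)$ with $Mg \in L_1(\mathbb{R}^3)$, and set $\|g\|_{H_1} = \|Mg\|_1$. For a measurable function $h$ on $\mathbb{R}^3$ let $$\|h\|_{\mathrm{BMO}} = \sup\left\{\left|\int_{\mathbb{R}^3} h g\,dx\right|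 : g \in H_1(\mathbb{R}^3),\ \|g\|_{H_1} \le 1,\ hg \in L_1(\mathbb{R}^3)\right\} \in [0,\infty]$$ be its dual norm (the condition $hg \in L_1$ is void if $hg$ is integrable for every $g \in H_1$). Theorem. There is no constant $c < \infty$ such that $$\left(\int_{-\infty}^{\infty} \|B_t f\|_{\mathrm{BMO}}^2\,dt\right)^{1/2} \le c\,\|f\|_2 \qquad\text{for all } f \in L_2(\mathbb{R}^3).$$ -/

import Mathlib

open MeasureTheory
open scoped ENNReal NNReal FourierTransform

noncomputable section

namespace WaveBMO

/-- Three-dimensional Euclidean space. -/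
abbrev R3 : Type := EuclideanSpace ℝ (Fin 3)

/-- The Hilbert space `L₂(ℝ³)` of complex-valued functions. -/
abbrev L2 : Type := Lp (α := R3) ℂ 2

/-! ### The wave propagator -/

/-- The Fourier multiplier `sin (t |ζ|) / |ζ|`. Mathlib's Fourier transform uses the character
`exp (-2 π i ⟪x, ξ⟫)`, so that the angular frequency is `ζ = 2 π ξ`. -/
def waveSymbol (t : ℝ) (ξ : R3) : ℝ :=
  Real.sin (t * (2 * Real.pi * ‖ξ‖)) / (2 * Real.pi * ‖ξ‖)

theorem abs_waveSymbol_le (t : ℝ) (ξ : R3) : |waveSymbol t ξ| ≤ |t| := by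
  have hr : 0 ≤ 2 * Real.pi * ‖ξ‖ := by positivity
  unfold waveSymbol
  rw [abs_div, abs_of_nonneg hr]
  refine div_le_of_le_mul₀ hr (abs_nonneg t) ?_
  calc |Real.sin (t * (2 * Real.pi * ‖ξ‖))| ≤ |t * (2 * Real.pi * ‖ξ‖)| := Real.abs_sin_le_abs
    _ = |t| * (2 * Real.pi * ‖ξ‖) := by rw [abs_mul, abs_of_nonneg hr]

theorem measurable_waveSymbol (t : ℝ) : Measurable (waveSymbol t) := by
  unfold waveSymbol
  fun_prop

/-- The product of the wave multiplier and an `L₂` function is in `L₂`. -/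
theorem memLp_waveSymbol_mul (t : ℝ) (f : L2) :
    MemLp (fun ξ : R3 => (waveSymbol t ξ : ℂ) * f ξ) 2 volume := by
  refine (Lp.memLp f).of_le_mul (c := |t|) ?_ (Filter.Eventually.of_forall fun ξ => ?_)
  · exact ((Complex.measurable_ofReal.comp
      (measurable_waveSymbol t)).aestronglyMeasurable).mul (Lp.aestronglyMeasurable f)
  · rw [norm_mul, Complex.norm_real, Real.norm_eq_abs]
    exact mul_le_mul_of_nonneg_right (abs_waveSymbol_le t ξ) (norm_nonneg _)

/-- `B t f = u (t, ·)`, where `u` is the solution of the wave equation `∂ₜ² u = Δ u` on `ℝ × ℝ³`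
with `u (0, ·) = 0` and `∂ₜ u (0, ·) = f`, that is, the Fourier transform of `B t f` is
`sin (t |ζ|) / |ζ|` times the Fourier transform of `f`. -/
def B (t : ℝ) (f : L2) : L2 :=
  𝓕⁻ ((memLp_waveSymbol_mul t (𝓕 f)).toLp)

/-! ### The Hardy space and the dual norm -/

/-- The heat kernel of `ℝ³` at time `s`. -/
def heatKernel (s : ℝ) (y : R3) : ℝ :=
  (4 * Real.pi * s) ^ (-(3 / 2 : ℝ)) * Real.exp (-‖y‖ ^ 2 / (4 * s))

/-- The heat maximal function of `g`. -/
def heatMaximal (g : R3 → ℂ) (x : R3) : ℝ≥0∞ :=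
  ⨆ (s : ℝ) (_ : 0 < s), ‖∫ y, (heatKernel s y : ℂ) * g (x - y)‖ₑ

/-- The norm of `H₁(ℝ³)`: the `L₁` norm of the heat maximal function. -/
def h1Norm (g : R3 → ℂ) : ℝ≥0∞ :=
  ∫⁻ x, heatMaximal g x

/-- Membership in `H₁(ℝ³)`, the subspace of `L₁(ℝ³)` of the functions with integrable heat
maximal function. -/
def MemH1 (g : R3 → ℂ) : Prop :=
  Integrable g ∧ h1Norm g < ∞

/-- The BMO norm by duality with `H₁(ℝ³)`, as an extended number: the supremum of `|∫ h g|` over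
the `g` in the unit ball of `H₁(ℝ³)` for which the integral exists. If `h g` is integrable for
all `g` in `H₁(ℝ³)`, the integrability constraint is void and this is the norm of the functional
`g ↦ ∫ h g` on `H₁(ℝ³)`. -/
def bmoNorm (h : R3 → ℂ) : ℝ≥0∞ :=
  ⨆ (g : R3 → ℂ) (_ : MemH1 g) (_ : h1Norm g ≤ 1) (_ : Integrable fun x => h x * g x),
    ‖∫ x, h x * g x‖ₑ

end WaveBMO

end

noncomputable section

namespace WaveBMO

open Filter Topology
open scoped SchwartzMap ComplexConjugate

/-! ### Multiplicative random walks -/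

/-! The estimate is dualized and tested on a random superposition of waves that follows a light ray.
Fix a real Schwartz function `φ` in the unit ball of `H₁` (`exists_schwartz_memH1`). Every translate
of `φ` is also in the unit ball, so on each time interval `(j, j + 1]` the BMO norm may be tested
against its own translate, by `a j`. By duality, the assumed bound gives `‖G‖₂² ≤ N c²` for `G = ∑ⱼ
∫_j^{j+1} B t (φ(· - a j)) dt`, uniformly in the points `a j`; this is `lintegral_dualSum_sq_le`,
with `dualSum` the Fourier transform of `G`.

Now let `a j` be a random walk with steps `(1, ±1, 0)`. In the angular frequency `ζ = 2πξ`, with `r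
= |ζ|`, the transform of `G` is a fixed factor times the difference of two sums of multiplicative
walks on the circle, whose steps have phases `±r - ζ₁ ∓' ζ₂` (`dualSum_walkPos`). If the mean step
is `q`, the mean square of such a sum is asymptotic to `N (1 - |q|²) / |1 - q|²`
(`tendsto_walkSq_div`). Here `q = exp(iA) cos y` with `A = ±r - ζ₁` and `y = ζ₂`.

Near `ζ = (1, 0, 0)`, in the cone `0 < ζ₃ < ζ₂`, the forward phase `A = r - ζ₁` is `O(y²)`, so `|1 -
q|` is `O(y²)` while `1 - |q|²` is of order `y²`: the limit is at least a constant times `1 / y²`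
(`resonant_limit_ge`). The backward phase is close to `-2` and contributes only `O(y²)`
(`nonresonant_limit_le`). After division by `N`, Fatou's lemma bounds the integral of `1 / ζ₂²` over
the cone by a multiple of `c²`. Integrating out `ζ₃` leaves `∫ dζ₂ / ζ₂`, which diverges
logarithmically (`lintegral_iUnion_dyadicBox`). -/

/-- The product of the first `j` steps of a multiplicative walk. -/
def walkProd (u : Bool → ℂ) {N : ℕ} (ω : Fin N → Bool) (j : ℕ) : ℂ :=
  ∏ l : Fin N, if (l : ℕ) < j then u (ω l) else 1

/-- The sum of the first `N` positions of a multiplicative walk. -/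
def walkSum (u : Bool → ℂ) {N : ℕ} (ω : Fin N → Bool) : ℂ :=
  ∑ j ∈ Finset.range N, walkProd u ω j

/-- The mean square of `walkSum`. -/
def walkSq (u : Bool → ℂ) (N : ℕ) : ℝ :=
  (∑ ω : Fin N → Bool, ‖walkSum u ω‖ ^ 2) / 2 ^ N

theorem walkProd_zero (u : Bool → ℂ) {N : ℕ} (ω : Fin N → Bool) : walkProd u ω 0 = 1 := by
  simp [walkProd]

theorem walkProd_cons (u : Bool → ℂ) {N : ℕ} (b : Bool) (ω : Fin N → Bool) (j : ℕ) :
    walkProd u (Fin.cons b ω : Fin (N + 1) → Bool) (j + 1) = u b * walkProd u ω j := by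
  simp [walkProd, Fin.prod_univ_succ]

/-- The bound `j ≤ N` matters: `walkProd` has only `min j N` nontrivial factors. -/
theorem walkProd_smul (a : ℂ) (u : Bool → ℂ) {N : ℕ} (ω : Fin N → Bool) {j : ℕ} (hj : j ≤ N) :
    walkProd (fun b => a * u b) ω j = a ^ j * walkProd u ω j := by
  induction N generalizing j with
  | zero => obtain rfl : j = 0 := by omega
            simp [walkProd_zero]
  | succ N ih =>
    cases j with
    | zero => simp [walkProd_zero]
    | succ j =>
      rw [← Fin.cons_self_tail ω, walkProd_cons, walkProd_cons, ih _ (by omega)]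
      ring

theorem walkSum_cons (u : Bool → ℂ) {N : ℕ} (b : Bool) (ω : Fin N → Bool) :
    walkSum u (Fin.cons b ω : Fin (N + 1) → Bool) = 1 + u b * walkSum u ω := by
  rw [walkSum, Finset.sum_range_succ', walkProd_zero, add_comm]
  simp_rw [walkProd_cons, walkSum, Finset.mul_sum]

theorem sum_bool_functions_succ {M : Type*} [AddCommMonoid M] {N : ℕ}
    (F : (Fin (N + 1) → Bool) → M) :
    ∑ ω, F ω = ∑ ω : Fin N → Bool, (F (Fin.cons true ω) + F (Fin.cons false ω)) := by
  rw [← Fintype.sum_equiv (Fin.consEquiv fun _ : Fin (N + 1) => Bool)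
    (fun p => F (Fin.cons p.1 p.2)) F (fun p => rfl), Fintype.sum_prod_type, Fintype.sum_bool,
    Finset.sum_add_distrib]

theorem sum_walkSum (u : Bool → ℂ) (N : ℕ) :
    ∑ ω : Fin N → Bool, walkSum u ω =
      2 ^ N * ∑ j ∈ Finset.range N, ((u true + u false) / 2) ^ j := by
  induction N with
  | zero => simp [walkSum]
  | succ N ih =>
    rw [sum_bool_functions_succ, Finset.sum_range_succ']
    simp_rw [walkSum_cons, pow_succ, ← Finset.sum_mul]
    have : ∀ ω : Fin N → Bool, 1 + u true * walkSum u ω + (1 + u false * walkSum u ω) =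
      2 + (u true + u false) * walkSum u ω := fun ω => by ring
    simp_rw [this, Finset.sum_add_distrib, ← Finset.mul_sum, ih]
    simp
    ring

/-- Splitting off the first step turns the sum into `1 + u b * S` with `S` an independent shorter
walk sum. Since `|u b| = 1`, expanding the square leaves `|S|²` and a cross term that depends only
on the mean of `S`. -/
theorem walkSq_succ (u : Bool → ℂ) (hu : ∀ b, ‖u b‖ = 1) (N : ℕ) :
    walkSq u (N + 1) = walkSq u N + (1 + 2 * ((u true + u false) / 2 *
      ∑ j ∈ Finset.range N, ((u true + u false) / 2) ^ j).re) := by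
  have key : ∀ b (ω : Fin N → Bool), ‖1 + u b * walkSum u ω‖ ^ 2 =
      1 + 2 * (u b * walkSum u ω).re + ‖walkSum u ω‖ ^ 2 := by
    intro b ω
    have h1 : ‖u b * walkSum u ω‖ ^ 2 = ‖walkSum u ω‖ ^ 2 := by rw [norm_mul, hu, one_mul]
    rw [← h1, ← Complex.normSq_eq_norm_sq, ← Complex.normSq_eq_norm_sq, Complex.normSq_add]
    simp
    ring
  have h2 : ∀ ω : Fin N → Bool, ‖1 + u true * walkSum u ω‖ ^ 2 + ‖1 + u false * walkSum u ω‖ ^ 2 =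
      2 + 2 * ((u true + u false) * walkSum u ω).re + 2 * ‖walkSum u ω‖ ^ 2 := by
    intro ω
    rw [key, key, add_mul, Complex.add_re]
    ring
  have h3 : ∑ ω : Fin N → Bool, ((u true + u false) * walkSum u ω).re =
      2 ^ N * (2 * ((u true + u false) / 2 *
        ∑ j ∈ Finset.range N, ((u true + u false) / 2) ^ j).re) := by
    rw [← Complex.re_sum, ← Finset.mul_sum, sum_walkSum]
    have : (u true + u false) * (2 ^ N * ∑ j ∈ Finset.range N, ((u true + u false) / 2) ^ j) =
      ((2 ^ N * 2 : ℝ) : ℂ) * ((u true + u false) / 2 *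
        ∑ j ∈ Finset.range N, ((u true + u false) / 2) ^ j) := by push_cast; ring
    rw [this, Complex.re_ofReal_mul]
    ring
  unfold walkSq
  rw [sum_bool_functions_succ]
  simp_rw [walkSum_cons, h2, Finset.sum_add_distrib, ← Finset.mul_sum, h3]
  simp
  field_simp
  ring

/-- The increments of `walkSq` converge to `1 + 2 Re (q / (1 - q))` by the geometric series, so
their Cesàro means do too; this number equals the stated quotient. -/
theorem tendsto_walkSq_div (u : Bool → ℂ) (hu : ∀ b, ‖u b‖ = 1)
    (hq : ‖(u true + u false) / 2‖ < 1) :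
    Tendsto (fun N : ℕ => walkSq u N / N) atTop
      (𝓝 ((1 - ‖(u true + u false) / 2‖ ^ 2) / ‖1 - (u true + u false) / 2‖ ^ 2)) := by
  set q := (u true + u false) / 2 with hqdef
  have h1 : ∀ N, walkSq u N =
      ∑ n ∈ Finset.range N, (1 + 2 * (q * ∑ j ∈ Finset.range n, q ^ j).re) := by
    intro N
    induction N with
    | zero => simp [walkSq, walkSum]
    | succ N ih => rw [Finset.sum_range_succ, ← ih, walkSq_succ u hu]
  have h2 : Tendsto (fun n => 1 + 2 * (q * ∑ j ∈ Finset.range n, q ^ j).re) atTop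
      (𝓝 (1 + 2 * (q * (1 - q)⁻¹).re)) := by
    have := (hasSum_geometric_of_norm_lt_one hq).tendsto_sum_nat
    exact (((Complex.continuous_re.tendsto _).comp (this.const_mul q)).const_mul 2).const_add 1
  have hne : (1 - q) ≠ 0 := fun h => by
    rw [← sub_eq_zero.1 h] at hq
    simp at hq
  have h3 : 1 + 2 * (q * (1 - q)⁻¹).re = (1 - ‖q‖ ^ 2) / ‖1 - q‖ ^ 2 := by
    have h4 : Complex.normSq (1 - q) ≠ 0 := by simpa using hne
    rw [← Complex.normSq_eq_norm_sq, ← Complex.normSq_eq_norm_sq, Complex.mul_re,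
      Complex.inv_re, Complex.inv_im, eq_div_iff h4]
    field_simp
    rw [Complex.normSq_apply, Complex.normSq_apply]
    simp
    ring
  rw [← h3]
  refine (h2.cesaro).congr fun N => ?_
  rw [h1, div_eq_inv_mul]

/-! ### The mean square of a walk on the circle -/

/-- The sign attached to a Boolean. -/
def boolSign (b : Bool) : ℝ := if b then 1 else -1

/-- A symmetric random step of size `y` on the unit circle, with drift `A`. -/
def circleStep (A y : ℝ) (b : Bool) : ℂ := Complex.exp ((A - boolSign b * y : ℝ) * Complex.I)

theorem norm_circleStep (A y : ℝ) (b : Bool) : ‖circleStep A y b‖ = 1 :=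
  Complex.norm_exp_ofReal_mul_I _

theorem circleStep_mean (A y : ℝ) :
    (circleStep A y true + circleStep A y false) / 2 =
      Complex.exp (A * Complex.I) * (Real.cos y : ℂ) := by
  have h : (Real.cos y : ℂ) =
      (Complex.exp (y * Complex.I) + Complex.exp (-y * Complex.I)) / 2 := by
    rw [Complex.ofReal_cos, Complex.cos]
  rw [h, mul_div_assoc', mul_add, ← Complex.exp_add, ← Complex.exp_add, add_comm]
  simp only [circleStep, boolSign]
  push_cast
  congr 3 <;> simp <;> ring

theorem norm_circleStep_mean (A : ℝ) {y : ℝ} (hy : 0 ≤ Real.cos y) :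
    ‖(circleStep A y true + circleStep A y false) / 2‖ = Real.cos y := by
  rw [circleStep_mean, norm_mul, Complex.norm_exp_ofReal_mul_I, one_mul, Complex.norm_real,
    Real.norm_of_nonneg hy]

theorem cos_mem_Ioo {y : ℝ} (h0 : 0 < y) (h1 : y ≤ 1 / 4) : 0 < Real.cos y ∧ Real.cos y < 1 := by
  have hpi := Real.pi_gt_three
  refine ⟨Real.cos_pos_of_mem_Ioo ⟨by linarith, by linarith⟩, ?_⟩
  rw [← Real.cos_zero]
  exact Real.cos_lt_cos_of_nonneg_of_le_pi le_rfl (by linarith) h0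

theorem one_sub_cos_sq_ge {y : ℝ} (h0 : 0 < y) (h1 : y ≤ 1 / 4) :
    y ^ 2 / 4 ≤ 1 - Real.cos y ^ 2 := by
  rw [← Real.sin_sq]
  have h2 : y / 2 ≤ Real.sin y := by
    have := Real.sin_gt_sub_cube h0
    nlinarith [mul_pos h0 h0, mul_nonneg h0.le (mul_nonneg h0.le (sub_nonneg.2 h1))]
  calc y ^ 2 / 4 = (y / 2) ^ 2 := by ring
    _ ≤ _ := by gcongr

theorem one_sub_cos_sq_le (y : ℝ) : 1 - Real.cos y ^ 2 ≤ y ^ 2 := by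
  rw [← Real.sin_sq]
  exact sq_le_sq.2 Real.abs_sin_le_abs

/-- With `q = exp(iA) cos y`, both `1 - cos y` and `|A|` are `O(y²)`, whence `|1 - q| ≤ 3y²`,
whereas `1 - |q|² = sin² y ≥ y² / 4`. The constant is `36 = 4 · 3²`. -/
theorem resonant_limit_ge {A y : ℝ} (h0 : 0 < y) (h1 : y ≤ 1 / 4) (hA : |A| ≤ 2 * y ^ 2) :
    1 / (36 * y ^ 2) ≤ (1 - ‖(circleStep A y true + circleStep A y false) / 2‖ ^ 2) /
      ‖1 - (circleStep A y true + circleStep A y false) / 2‖ ^ 2 := by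
  obtain ⟨hc0, hc1⟩ := cos_mem_Ioo h0 h1
  set q := (circleStep A y true + circleStep A y false) / 2 with hq
  have hqn : ‖q‖ = Real.cos y := norm_circleStep_mean A hc0.le
  have hpos : 0 < ‖1 - q‖ := by
    have := norm_sub_norm_le (1 : ℂ) q
    rw [norm_one, hqn] at this
    linarith
  have hle : ‖1 - q‖ ≤ 3 * y ^ 2 := by
    have e : 1 - q = ((1 - Real.cos y : ℝ) : ℂ) -
        (Real.cos y : ℂ) * (Complex.exp (Complex.I * A) - 1) := by
      rw [hq, circleStep_mean, mul_comm Complex.I]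
      push_cast
      ring
    have h2 : ‖Complex.exp (Complex.I * A) - 1‖ ≤ ‖A‖ := Real.norm_exp_I_mul_ofReal_sub_one_le
    have h3 := Real.one_sub_sq_div_two_le_cos (x := y)
    calc ‖1 - q‖ ≤ ‖((1 - Real.cos y : ℝ) : ℂ)‖ +
          ‖(Real.cos y : ℂ) * (Complex.exp (Complex.I * A) - 1)‖ := by rw [e]; exact norm_sub_le _ _
      _ ≤ (1 - Real.cos y) + 1 * |A| := by
        rw [norm_mul, Complex.norm_real, Complex.norm_real, Real.norm_of_nonneg hc0.le,
          Real.norm_of_nonneg (by linarith : 0 ≤ 1 - Real.cos y)]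
        gcongr
        exact h2
      _ ≤ 3 * y ^ 2 := by nlinarith [sq_nonneg y]
  rw [hqn, div_le_div_iff₀ (by positivity) (by positivity), one_mul]
  calc ‖1 - q‖ ^ 2 ≤ (3 * y ^ 2) ^ 2 := by gcongr
    _ = y ^ 2 / 4 * (36 * y ^ 2) := by ring
    _ ≤ _ := by gcongr; exact one_sub_cos_sq_ge h0 h1

/-- Here `Re q ≤ 0`, so `|1 - q| ≥ 1` and only the numerator `sin² y` remains. -/
theorem nonresonant_limit_le {A y : ℝ} (h0 : 0 < y) (h1 : y ≤ 1 / 4) (hA : Real.cos A ≤ 0) :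
    (1 - ‖(circleStep A y true + circleStep A y false) / 2‖ ^ 2) /
      ‖1 - (circleStep A y true + circleStep A y false) / 2‖ ^ 2 ≤ y ^ 2 := by
  obtain ⟨hc0, hc1⟩ := cos_mem_Ioo h0 h1
  set q := (circleStep A y true + circleStep A y false) / 2 with hq
  have hqn : ‖q‖ = Real.cos y := norm_circleStep_mean A hc0.le
  have hre : 1 ≤ ‖1 - q‖ := by
    refine le_trans ?_ (Complex.re_le_norm _)
    have : q.re = Real.cos A * Real.cos y := by
      rw [hq, circleStep_mean, Complex.re_mul_ofReal, Complex.exp_ofReal_mul_I_re]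
    rw [Complex.sub_re, this, Complex.one_re]
    nlinarith
  rw [hqn]
  refine (div_le_self ?_ (one_le_pow₀ hre)).trans (one_sub_cos_sq_le y)
  nlinarith

/-- The combination `X / 2 - Y` is the one that bounds the square of a difference from below in
`weight_mul_le`. The resonant half is `1 / (72 y²)`; the nonresonant term is at most half of it
because `y ≤ 1/4`. -/
theorem exists_tendsto_walkSq_sub {r a y : ℝ} (h0 : 0 < y) (h1 : y ≤ 1 / 4)
    (hA : |r - a| ≤ 2 * y ^ 2) (hc : Real.cos (r + a) ≤ 0) :
    ∃ L, 1 / (144 * y ^ 2) ≤ L ∧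
      Tendsto (fun N : ℕ => (walkSq (circleStep (r - a) y) N / 2 -
        walkSq (circleStep (-r - a) y) N) / N) atTop (𝓝 L) := by
  obtain ⟨hc0, hc1⟩ := cos_mem_Ioo h0 h1
  have t1 := tendsto_walkSq_div (circleStep (r - a) y) (norm_circleStep _ _)
    (by rw [norm_circleStep_mean _ hc0.le]; exact hc1)
  have t2 := tendsto_walkSq_div (circleStep (-r - a) y) (norm_circleStep _ _)
    (by rw [norm_circleStep_mean _ hc0.le]; exact hc1)
  have l1 := resonant_limit_ge h0 h1 hA
  have l2 := nonresonant_limit_le (A := -r - a) h0 h1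
    (by rw [show -r - a = -(r + a) by ring, Real.cos_neg]; exact hc)
  refine ⟨_, ?_, ((t1.div_const 2).sub t2).congr fun N => by ring⟩
  have h2 : 1 / (144 * y ^ 2) ≤ 1 / (36 * y ^ 2) / 2 - y ^ 2 := by
    have h3 : y ^ 2 ≤ 1 / 16 := by nlinarith
    have h4 : y ^ 2 ≤ 1 / (144 * y ^ 2) := by
      rw [le_div_iff₀ (by positivity)]
      nlinarith [sq_nonneg y]
    have h5 : 1 / (36 * y ^ 2) / 2 = 2 * (1 / (144 * y ^ 2)) := by field_simp; norm_num
    linarith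
  linarith

/-! ### A Schwartz function in the unit ball of the Hardy space -/

theorem heatKernel_nonneg {s : ℝ} (hs : 0 < s) (y : R3) : 0 ≤ heatKernel s y := by
  unfold heatKernel
  positivity

theorem integral_heatKernel {s : ℝ} (hs : 0 < s) : ∫ y, heatKernel s y = 1 := by
  have h := GaussianFourier.integral_rexp_neg_mul_sq_norm (V := R3) (b := 1 / (4 * s))
    (by positivity)
  have e : ∀ y : R3, heatKernel s y =
      (4 * Real.pi * s) ^ (-(3 / 2 : ℝ)) * Real.exp (-(1 / (4 * s)) * ‖y‖ ^ 2) := by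
    intro y
    unfold heatKernel
    congr 2
    ring
  have hb : Real.pi / (1 / (4 * s)) = 4 * Real.pi * s := by field_simp
  simp_rw [e]
  rw [integral_const_mul, h, hb, finrank_euclideanSpace_fin]
  push_cast
  rw [← Real.rpow_add (by positivity)]
  norm_num

theorem integrable_heatKernel {s : ℝ} (hs : 0 < s) : Integrable (heatKernel s) := by
  -- A nonintegrable function has integral `0` by convention, so the value `1` forces integrability.
  refine not_imp_comm.1 integral_undef ?_
  rw [integral_heatKernel hs]
  exact one_ne_zero

theorem abs_exp_neg_sub_exp_neg_le {a b m : ℝ} (ha : m ≤ a) (hb : m ≤ b) :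
    |Real.exp (-a) - Real.exp (-b)| ≤ |a - b| * Real.exp (-m) := by
  wlog hab : a ≤ b generalizing a b with H
  · rw [abs_sub_comm, abs_sub_comm a b]
    exact H hb ha (le_of_not_ge hab)
  have h1 : Real.exp (-b) ≤ Real.exp (-a) := Real.exp_le_exp.2 (by linarith)
  rw [abs_of_nonneg (by linarith), abs_sub_comm, abs_of_nonneg (by linarith)]
  have h2 : Real.exp (-b) = Real.exp (-a) * Real.exp (-(b - a)) := by
    rw [← Real.exp_add]; congr 1; ring
  have h3 := Real.one_sub_le_exp_neg (b - a)
  have h4 : Real.exp (-a) ≤ Real.exp (-m) := Real.exp_le_exp.2 (by linarith)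
  calc Real.exp (-a) - Real.exp (-b) = Real.exp (-a) * (1 - Real.exp (-(b - a))) := by
        rw [h2]; ring
    _ ≤ Real.exp (-a) * (b - a) :=
      mul_le_mul_of_nonneg_left (by linarith) (Real.exp_pos _).le
    _ ≤ (b - a) * Real.exp (-m) := by
      rw [mul_comm]
      exact mul_le_mul_of_nonneg_left h4 (by linarith)

/-- The constant is `7 = 1 + 3!`, from `w⁵ ≤ 1 + w⁶` and the cubic term of the exponential series in
`w²`. -/
theorem pow_five_mul_exp_neg_sq_le {w : ℝ} (hw : 0 ≤ w) : w ^ 5 * Real.exp (-w ^ 2) ≤ 7 := by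
  have h1 : w ^ 5 ≤ 1 + w ^ 6 := by
    rcases le_total w 1 with h | h
    · have := pow_le_one₀ (n := 5) hw h
      have : 0 ≤ w ^ 6 := by positivity
      linarith
    · have : w ^ 5 ≤ w ^ 6 := pow_le_pow_right₀ h (by norm_num)
      linarith
  have h2 := Real.pow_div_factorial_le_exp (w ^ 2) (by positivity) 3
  have h3 := Real.one_le_exp (x := w ^ 2) (by positivity)
  have h4 : (w ^ 2) ^ 3 = w ^ 6 := by ring
  rw [h4] at h2
  norm_num [Nat.factorial] at h2
  rw [Real.exp_neg, ← div_eq_mul_inv, div_le_iff₀ (Real.exp_pos _)]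
  linarith

/-- Since `‖x - y‖ ≥ ‖x‖ / 2`, both Gaussian exponents are at least `R² / (16s)`, and they differ by
at most `2R / s`. With `w = R / (4√s)` the resulting bound is `2 · 4⁵ R⁻⁴ w⁵ exp(-w²)`, uniformly
bounded in `s`. The gain of one power over the kernel's size `R⁻³` makes the maximal function
integrable. -/
theorem abs_heatKernel_sub_le {s : ℝ} (hs : 0 < s) {x y : R3} (hx : 4 ≤ ‖x‖) (hy : ‖y‖ ≤ 2) :
    |heatKernel s (x - y) - heatKernel s x| ≤ 14336 * ‖x‖⁻¹ ^ 4 := by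
  set R := ‖x‖ with hR
  have hR0 : 0 < R := by linarith
  have l1 : ‖x - y‖ ≤ R + 2 := (norm_sub_le _ _).trans (by linarith)
  have l2 : R - 2 ≤ ‖x - y‖ := le_trans (by linarith) (norm_sub_norm_le x y)
  have l3 : |‖x - y‖ - R| ≤ 2 := by rw [abs_le]; constructor <;> linarith
  have hm1 : R ^ 2 / (16 * s) ≤ ‖x - y‖ ^ 2 / (4 * s) := by
    rw [div_le_div_iff₀ (by positivity) (by positivity)]
    have : (R / 2) ^ 2 ≤ ‖x - y‖ ^ 2 := by gcongr; linarith
    nlinarith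
  have hm2 : R ^ 2 / (16 * s) ≤ R ^ 2 / (4 * s) := by gcongr; norm_num
  have h1 := abs_exp_neg_sub_exp_neg_le hm1 hm2
  have h2 : |‖x - y‖ ^ 2 / (4 * s) - R ^ 2 / (4 * s)| ≤ 2 * R / s := by
    rw [← sub_div, abs_div, abs_of_pos (by positivity : 0 < 4 * s),
      div_le_div_iff₀ (by positivity) hs, sq_sub_sq, abs_mul,
      abs_of_nonneg (by positivity : 0 ≤ ‖x - y‖ + R)]
    calc (‖x - y‖ + R) * |‖x - y‖ - R| * s ≤ (4 * R) * 2 * s := by gcongr; linarith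
      _ = _ := by ring
  set σ := Real.sqrt s with hσ
  have hσ0 : 0 < σ := Real.sqrt_pos.2 hs
  have hσs : s = σ ^ 2 := (Real.sq_sqrt hs.le).symm
  have h3 : (4 * Real.pi * s) ^ (-(3 / 2 : ℝ)) ≤ 1 / σ ^ 3 := by
    have : s ^ (-(3 / 2 : ℝ)) = 1 / σ ^ 3 := by
      rw [hσs, ← Real.rpow_natCast σ 2, ← Real.rpow_mul hσ0.le, one_div, ← Real.rpow_natCast σ 3,
        ← Real.rpow_neg hσ0.le]
      norm_num
    rw [← this]
    refine Real.rpow_le_rpow_of_nonpos hs ?_ (by norm_num)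
    nlinarith [Real.pi_gt_three]
  have e : heatKernel s (x - y) - heatKernel s x = (4 * Real.pi * s) ^ (-(3 / 2 : ℝ)) *
      (Real.exp (-(‖x - y‖ ^ 2 / (4 * s))) - Real.exp (-(R ^ 2 / (4 * s)))) := by
    unfold heatKernel
    rw [neg_div, neg_div, ← hR]
    ring
  rw [e, abs_mul, abs_of_nonneg (by positivity : 0 ≤ (4 * Real.pi * s) ^ (-(3 / 2 : ℝ)))]
  have h5 := pow_five_mul_exp_neg_sq_le (w := R / (4 * σ)) (by positivity)
  calc _ ≤ 1 / σ ^ 3 * (2 * R / s * Real.exp (-(R ^ 2 / (16 * s)))) := by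
        gcongr
        exact h1.trans (by gcongr)
    _ = 2048 * R⁻¹ ^ 4 * ((R / (4 * σ)) ^ 5 * Real.exp (-(R / (4 * σ)) ^ 2)) := by
      have : (R / (4 * σ)) ^ 2 = R ^ 2 / (16 * s) := by rw [hσs]; field_simp; norm_num
      rw [this, hσs]
      field_simp
      norm_num
    _ ≤ 2048 * R⁻¹ ^ 4 * 7 := by gcongr
    _ = _ := by ring

/-- Far from the support, the vanishing mean allows `heatKernel s x` to be subtracted from the
kernel, giving decay of order four. Near it, the bound `A` suffices because the kernel has integral
one, and `625 = 5⁴` compensates for the weight when `‖x‖ < 4`. -/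
theorem heatMaximal_le_of_atom {φ : R3 → ℂ} (hφ : Integrable φ) {A : ℝ} (hA : ∀ x, ‖φ x‖ ≤ A)
    (hsupp : ∀ x, 2 < ‖x‖ → φ x = 0) (h0 : ∫ x, φ x = 0) :
    ∃ C : ℝ, 0 ≤ C ∧ ∀ x, heatMaximal φ x ≤ ENNReal.ofReal (C * (1 + ‖x‖) ^ (-4 : ℝ)) := by
  have hA0 : 0 ≤ A := (norm_nonneg _).trans (hA 0)
  have hI : 0 ≤ ∫ x, ‖φ x‖ := integral_nonneg fun _ => norm_nonneg _
  refine ⟨625 * A + 43008 * ∫ x, ‖φ x‖, by positivity, fun x => iSup₂_le fun s hs => ?_⟩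
  rw [← ofReal_norm]
  refine ENNReal.ofReal_le_ofReal ?_
  have hpw : (1 + ‖x‖) ^ (-4 : ℝ) = (1 + ‖x‖)⁻¹ ^ 4 := by
    rw [Real.rpow_neg (by positivity), inv_pow]
    norm_cast
  rw [hpw]
  have hp0 : 0 ≤ (1 + ‖x‖)⁻¹ ^ 4 := by positivity
  rcases le_or_gt 4 ‖x‖ with hx | hx
  · have e1 : ∫ y, (heatKernel s y : ℂ) * φ (x - y) = ∫ y, (heatKernel s (x - y) : ℂ) * φ y := by
      rw [← integral_sub_left_eq_self _ volume x]
      simp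
    have i1 : Integrable fun y => ((heatKernel s (x - y) - heatKernel s x : ℝ) : ℂ) * φ y := by
      have hcont : Continuous fun y : R3 => heatKernel s (x - y) - heatKernel s x := by
        unfold heatKernel
        fun_prop
      refine (hφ.norm.const_mul (14336 * ‖x‖⁻¹ ^ 4)).mono'
        ((Complex.continuous_ofReal.comp hcont).aestronglyMeasurable.mul
          hφ.aestronglyMeasurable) (Eventually.of_forall fun y => ?_)
      rcases le_or_gt ‖y‖ 2 with hy | hy
      · rw [norm_mul, Complex.norm_real]
        gcongr
        exact abs_heatKernel_sub_le hs hx hy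
      · simp [hsupp y hy]
    have e2 : ∫ y, (heatKernel s (x - y) : ℂ) * φ y =
        ∫ y, ((heatKernel s (x - y) - heatKernel s x : ℝ) : ℂ) * φ y := by
      rw [← add_zero (∫ y, ((heatKernel s (x - y) - heatKernel s x : ℝ) : ℂ) * φ y),
        ← mul_zero (heatKernel s x : ℂ), ← h0, ← integral_const_mul,
        ← integral_add i1 (hφ.const_mul _)]
      congr 1
      ext y
      push_cast
      ring
    rw [e1, e2]
    have hx3 : ‖x‖⁻¹ ^ 4 ≤ 3 * (1 + ‖x‖)⁻¹ ^ 4 := by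
      have : ‖x‖⁻¹ ≤ 5 / 4 * (1 + ‖x‖)⁻¹ := by
        rw [← div_eq_mul_inv, le_div_iff₀ (by positivity), inv_mul_le_iff₀ (by linarith)]
        linarith
      calc ‖x‖⁻¹ ^ 4 ≤ (5 / 4 * (1 + ‖x‖)⁻¹) ^ 4 := by gcongr
        _ = 625 / 256 * (1 + ‖x‖)⁻¹ ^ 4 := by ring
        _ ≤ _ := by gcongr; norm_num
    calc _ ≤ ∫ y, 14336 * ‖x‖⁻¹ ^ 4 * ‖φ y‖ := by
          refine norm_integral_le_of_norm_le (hφ.norm.const_mul _)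
            (Eventually.of_forall fun y => ?_)
          rcases le_or_gt ‖y‖ 2 with hy | hy
          · rw [norm_mul, Complex.norm_real]
            gcongr
            exact abs_heatKernel_sub_le hs hx hy
          · simp [hsupp y hy]
      _ = 14336 * ‖x‖⁻¹ ^ 4 * ∫ y, ‖φ y‖ := integral_const_mul _ _
      _ ≤ 14336 * (3 * (1 + ‖x‖)⁻¹ ^ 4) * ∫ y, ‖φ y‖ := by gcongr
      _ = 43008 * (∫ y, ‖φ y‖) * (1 + ‖x‖)⁻¹ ^ 4 := by ring
      _ ≤ _ := by gcongr; linarith [mul_nonneg (by norm_num : (0 : ℝ) ≤ 625) hA0]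
  · have h1 : (1 : ℝ) ≤ 625 * (1 + ‖x‖)⁻¹ ^ 4 := by
      have : (1 : ℝ) / 5 ≤ (1 + ‖x‖)⁻¹ := by
        rw [one_div]
        exact inv_anti₀ (by positivity) (by linarith)
      calc (1 : ℝ) = 625 * (1 / 5) ^ 4 := by norm_num
        _ ≤ _ := by gcongr
    calc _ ≤ ∫ y, heatKernel s y * A := by
          refine norm_integral_le_of_norm_le ((integrable_heatKernel hs).mul_const _)
            (Eventually.of_forall fun y => ?_)
          rw [norm_mul, Complex.norm_real, Real.norm_of_nonneg (heatKernel_nonneg hs y)]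
          exact mul_le_mul_of_nonneg_left (hA _) (heatKernel_nonneg hs y)
      _ = A := by rw [integral_mul_const, integral_heatKernel hs, one_mul]
      _ ≤ A * (625 * (1 + ‖x‖)⁻¹ ^ 4) := le_mul_of_one_le_right hA0 h1
      _ = 625 * A * (1 + ‖x‖)⁻¹ ^ 4 := by ring
      _ ≤ _ := by gcongr; linarith [mul_nonneg (by norm_num : (0 : ℝ) ≤ 43008) hI]

theorem h1Norm_lt_top_of_atom {φ : R3 → ℂ} (hφ : Integrable φ) {A : ℝ} (hA : ∀ x, ‖φ x‖ ≤ A)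
    (hsupp : ∀ x, 2 < ‖x‖ → φ x = 0) (h0 : ∫ x, φ x = 0) : h1Norm φ < ∞ := by
  obtain ⟨C, hC, h⟩ := heatMaximal_le_of_atom hφ hA hsupp h0
  refine (lintegral_mono h).trans_lt ?_
  have hint : Integrable (fun x : R3 => C * (1 + ‖x‖) ^ (-4 : ℝ)) :=
    (integrable_one_add_norm (by norm_num)).const_mul C
  exact hint.lintegral_lt_top

theorem h1Norm_translate (φ : R3 → ℂ) (a : R3) : h1Norm (fun x => φ (x - a)) = h1Norm φ := by
  have h : ∀ x, heatMaximal (fun x => φ (x - a)) x = heatMaximal φ (x - a) := by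
    intro x
    unfold heatMaximal
    simp_rw [sub_right_comm]
  unfold h1Norm
  simp_rw [h]
  exact lintegral_sub_right_eq_self (heatMaximal φ) a

theorem h1Norm_const_mul (c : ℂ) (φ : R3 → ℂ) : h1Norm (fun x => c * φ x) = ‖c‖ₑ * h1Norm φ := by
  have h : ∀ x, heatMaximal (fun x => c * φ x) x = ‖c‖ₑ * heatMaximal φ x := by
    intro x
    unfold heatMaximal
    simp_rw [ENNReal.mul_iSup, ← enorm_mul, ← integral_const_mul]
    congr! 6
    ring
  unfold h1Norm
  simp_rw [h]
  exact lintegral_const_mul' _ _ enorm_ne_top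

theorem MemH1.translate {φ : R3 → ℂ} (h : MemH1 φ) (a : R3) : MemH1 fun x => φ (x - a) :=
  ⟨h.1.comp_sub_right a, by rw [h1Norm_translate]; exact h.2⟩

theorem fourier_translate (φ : R3 → ℂ) (a ξ : R3) :
    𝓕 (fun x => φ (x - a)) ξ =
      Complex.exp ((-2 * Real.pi * inner ℝ a ξ : ℝ) * Complex.I) * 𝓕 φ ξ := by
  rw [Real.fourier_eq', Real.fourier_eq', ← integral_add_right_eq_self _ a, ← integral_const_mul]
  congr 1
  ext x
  simp only [add_sub_cancel_right, smul_eq_mul, inner_add_left]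
  rw [← mul_assoc, ← Complex.exp_add]
  congr 2
  push_cast
  ring

/-- The frequency `(1, 0, 0) / (2 π)`. -/
def baseFrequency : R3 := !₂[1 / (2 * Real.pi), 0, 0]

theorem norm_baseFrequency : ‖baseFrequency‖ = 1 / (2 * Real.pi) := by
  rw [baseFrequency, EuclideanSpace.norm_eq, Fin.sum_univ_three]
  simp [Real.sqrt_sq_eq_abs, abs_of_pos Real.pi_pos]

/-- On the unit ball the phase is at most `1` in absolute value, because the angular frequency has
norm one. Its cosine is then at least `1/2`, so the real part of the transform is positive. -/
theorem fourier_bump_ne_zero {ψ : R3 → ℝ} (hψ : Integrable ψ) (h0 : ∀ x, 0 ≤ ψ x)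
    (hsupp : ∀ x, 1 ≤ ‖x‖ → ψ x = 0) (hpos : 0 < ∫ x, ψ x) :
    𝓕 (fun x => (ψ x : ℂ)) baseFrequency ≠ 0 := by
  rw [Real.fourier_eq']
  have hmeas : AEStronglyMeasurable (fun v : R3 =>
      Complex.exp ((-2 * Real.pi * inner ℝ v baseFrequency : ℝ) * Complex.I) • (ψ v : ℂ)) := by
    have hc : Continuous fun v : R3 =>
        Complex.exp ((-2 * Real.pi * inner ℝ v baseFrequency : ℝ) * Complex.I) := by fun_prop
    refine AEStronglyMeasurable.smul hc.aestronglyMeasurable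
      (Complex.continuous_ofReal.comp_aestronglyMeasurable hψ.aestronglyMeasurable)
  have hint : Integrable (fun v : R3 =>
      Complex.exp ((-2 * Real.pi * inner ℝ v baseFrequency : ℝ) * Complex.I) • (ψ v : ℂ)) := by
    refine hψ.norm.mono' hmeas (Eventually.of_forall fun v => ?_)
    rw [norm_smul, Complex.norm_exp_ofReal_mul_I, one_mul, Complex.norm_real]
  have hre : ∀ v : R3, (Complex.exp ((-2 * Real.pi * inner ℝ v baseFrequency : ℝ) * Complex.I) •
      (ψ v : ℂ)).re = Real.cos (-2 * Real.pi * inner ℝ v baseFrequency) * ψ v := by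
    intro v
    rw [smul_eq_mul, Complex.re_mul_ofReal, Complex.exp_ofReal_mul_I_re]
  have hge : ∀ v : R3, 1 / 2 * ψ v ≤ (Complex.exp ((-2 * Real.pi *
      inner ℝ v baseFrequency : ℝ) * Complex.I) • (ψ v : ℂ)).re := by
    intro v
    rw [hre]
    rcases le_or_gt 1 ‖v‖ with hv | hv
    · simp [hsupp v hv]
    · refine mul_le_mul_of_nonneg_right ?_ (h0 v)
      have h1 : |-2 * Real.pi * inner ℝ v baseFrequency| ≤ 1 := by
        have h2 := abs_real_inner_le_norm v baseFrequency
        rw [norm_baseFrequency] at h2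
        rw [abs_mul, abs_mul, abs_of_pos Real.pi_pos]
        norm_num
        calc 2 * Real.pi * |inner ℝ v baseFrequency|
            ≤ 2 * Real.pi * (1 * (1 / (2 * Real.pi))) := by
              have := Real.pi_pos
              gcongr
              exact h2.trans (by gcongr)
          _ = 1 := by field_simp
      have h3 := Real.one_sub_sq_div_two_le_cos (x := -2 * Real.pi * inner ℝ v baseFrequency)
      have h4 := (sq_le_one_iff_abs_le_one _).2 h1
      linarith
  intro h
  have h1 : ∫ v : R3, (Complex.exp ((-2 * Real.pi * inner ℝ v baseFrequency : ℝ) * Complex.I) •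
      (ψ v : ℂ)).re = 0 := by
    have := Complex.reCLM.integral_comp_comm hint
    simp only [Complex.reCLM_apply] at this
    rw [this, h, Complex.zero_re]
  have h2 := integral_mono (hψ.const_mul (1 / 2)) hint.re hge
  simp only [RCLike.re_eq_complex_re] at h2
  rw [h1, integral_const_mul] at h2
  linarith

/-- A real Schwartz function in the unit ball of `H₁(ℝ³)` whose Fourier transform does not vanish
at `baseFrequency`. -/
theorem exists_schwartz_memH1 : ∃ φ : 𝓢(R3, ℂ), (∀ x, conj (φ x) = φ x) ∧ MemH1 φ ∧
    h1Norm φ ≤ 1 ∧ 𝓕 (φ : R3 → ℂ) baseFrequency ≠ 0 := by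
  let ψ : ContDiffBump (0 : R3) := ⟨1 / 2, 1, by norm_num, by norm_num⟩
  have hψ0 : ∀ x, 1 ≤ ‖x‖ → ψ x = 0 := fun x hx =>
    ψ.zero_of_le_dist (by simpa [ψ] using hx)
  have hcs : HasCompactSupport fun x => (ψ x : ℂ) :=
    ψ.hasCompactSupport.comp_left (g := Complex.ofReal) Complex.ofReal_zero
  have hcd : ContDiff ℝ (⊤ : ℕ∞) fun x => (ψ x : ℂ) :=
    Complex.ofRealCLM.contDiff.comp ψ.contDiff
  let Ψ : 𝓢(R3, ℂ) := hcs.toSchwartzMap hcd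
  have hΨ : ∀ x, Ψ x = (ψ x : ℂ) := fun _ => rfl
  let e : R3 := !₂[1, 0, 0]
  have he : ‖e‖ = 1 := by
    rw [EuclideanSpace.norm_eq, Fin.sum_univ_three]
    simp [e]
  -- The difference of two translates has mean zero. At `baseFrequency` it multiplies the transform
  -- of the bump by `1 - exp(-i)`, which is nonzero.
  let φ₀ : 𝓢(R3, ℂ) := Ψ - SchwartzMap.compSubConstCLM ℂ e Ψ
  have hφ₀ : ∀ x, φ₀ x = ψ x - ψ (x - e) := fun x => rfl
  have hint : Integrable φ₀ := φ₀.integrable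
  have hsupp : ∀ x, 2 < ‖x‖ → φ₀ x = 0 := by
    intro x hx
    have := norm_sub_norm_le x e
    rw [hφ₀, hψ0 x (by linarith), hψ0 (x - e) (by linarith)]
    simp
  have hbd : ∀ x, ‖φ₀ x‖ ≤ 2 := by
    intro x
    rw [hφ₀, ← Complex.ofReal_sub, Complex.norm_real, Real.norm_eq_abs, abs_le]
    constructor <;> linarith [ψ.nonneg (x := x), ψ.le_one (x := x), ψ.nonneg (x := x - e),
      ψ.le_one (x := x - e)]
  have hzero : ∫ x, φ₀ x = 0 := by
    have i1 : Integrable fun x => Ψ x := Ψ.integrable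
    have : ∫ x, φ₀ x = ∫ x, (Ψ x - Ψ (x - e)) := rfl
    rw [this, integral_sub i1 (i1.comp_sub_right e), integral_sub_right_eq_self, sub_self]
  have hfin := h1Norm_lt_top_of_atom hint hbd hsupp hzero
  have hF : 𝓕 (φ₀ : R3 → ℂ) baseFrequency ≠ 0 := by
    have h1 : 𝓕 (φ₀ : R3 → ℂ) baseFrequency = 𝓕 (Ψ : R3 → ℂ) baseFrequency -
        𝓕 (fun x => Ψ (x - e)) baseFrequency := by
      have : 𝓕 φ₀ = 𝓕 Ψ - 𝓕 (SchwartzMap.compSubConstCLM ℂ e Ψ) :=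
        map_sub (FourierTransform.fourierCLM ℂ 𝓢(R3, ℂ)) _ _
      exact congrArg (fun g : 𝓢(R3, ℂ) => g baseFrequency) this
    have h2 : (-2 * Real.pi * inner ℝ e baseFrequency : ℝ) = -1 := by
      simp [e, baseFrequency, PiLp.inner_apply, Fin.sum_univ_three]
      field_simp
    rw [h1, fourier_translate, h2, ← one_sub_mul]
    refine mul_ne_zero (fun h => ?_)
      (fourier_bump_ne_zero ψ.integrable (fun x => ψ.nonneg) hψ0 ψ.integral_pos)
    have h3 := congrArg Complex.im h
    rw [Complex.sub_im, Complex.exp_ofReal_mul_I_im] at h3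
    have := Real.sin_pos_of_pos_of_lt_pi one_pos (by linarith [Real.pi_gt_three])
    simp at h3
    linarith
  -- Adding `1` makes it unnecessary to know that the norm is nonzero.
  set c : ℝ := ((h1Norm φ₀).toReal + 1)⁻¹ with hc
  have hc0 : 0 < c := by positivity
  have hle : h1Norm (fun x => (c : ℂ) * φ₀ x) ≤ 1 := by
    rw [h1Norm_const_mul, ← ofReal_norm, Complex.norm_real, Real.norm_of_nonneg hc0.le,
      ← ENNReal.ofReal_toReal hfin.ne, ← ENNReal.ofReal_mul hc0.le, ENNReal.ofReal_le_one, hc,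
      inv_mul_le_iff₀ (by positivity)]
    linarith
  refine ⟨(c : ℂ) • φ₀, fun x => ?_, ⟨SchwartzMap.integrable _, lt_of_le_of_lt hle (by simp)⟩, hle,
    ?_⟩
  · rw [smul_apply, hφ₀, smul_eq_mul, map_mul, map_sub]
    simp only [Complex.conj_ofReal]
  · have : 𝓕 ((c : ℂ) • φ₀) = (c : ℂ) • 𝓕 φ₀ :=
      map_smul (FourierTransform.fourierCLM ℂ 𝓢(R3, ℂ)) _ _
    have h2 : 𝓕 (((c : ℂ) • φ₀ : 𝓢(R3, ℂ)) : R3 → ℂ) baseFrequency =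
        (c : ℂ) • 𝓕 (φ₀ : R3 → ℂ) baseFrequency :=
      congrArg (fun g : 𝓢(R3, ℂ) => g baseFrequency) this
    rw [h2]
    exact smul_ne_zero (by exact_mod_cast hc0.ne') hF

/-! ### The dual estimate -/

/-- The integral of the wave multiplier over the time interval `(j, j + 1]`. -/
def waveAverage (j : ℕ) (ξ : R3) : ℝ := ∫ t in Set.Ioc (j : ℝ) (j + 1), waveSymbol t ξ

theorem waveAverage_eq (j : ℕ) (ξ : R3) :
    waveAverage j ξ = (Real.cos (j * (2 * Real.pi * ‖ξ‖)) -
      Real.cos ((j + 1) * (2 * Real.pi * ‖ξ‖))) / (2 * Real.pi * ‖ξ‖) ^ 2 := by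
  unfold waveAverage waveSymbol
  set ρ := 2 * Real.pi * ‖ξ‖ with hρ
  rw [← intervalIntegral.integral_of_le (by linarith), intervalIntegral.integral_div]
  rcases eq_or_ne ρ 0 with h | h
  · simp [h]
  · rw [intervalIntegral.integral_comp_mul_right (fun x => Real.sin x) h, integral_sin, smul_eq_mul]
    field_simp

theorem measurable_waveAverage (j : ℕ) : Measurable (waveAverage j) := by
  have : waveAverage j = fun ξ => (Real.cos (j * (2 * Real.pi * ‖ξ‖)) -
      Real.cos ((j + 1) * (2 * Real.pi * ‖ξ‖))) / (2 * Real.pi * ‖ξ‖) ^ 2 :=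
    funext (waveAverage_eq j)
  rw [this]
  fun_prop

theorem abs_waveAverage_le (j : ℕ) (ξ : R3) : |waveAverage j ξ| ≤ j + 1 := by
  have h : ∀ t ∈ Set.Ioc (j : ℝ) (j + 1), ‖waveSymbol t ξ‖ ≤ (j + 1 : ℝ) := by
    intro t ht
    have h0 : (0 : ℝ) ≤ j := Nat.cast_nonneg j
    refine (abs_waveSymbol_le t ξ).trans ?_
    rw [abs_of_nonneg (h0.trans ht.1.le)]
    exact ht.2
  have := norm_setIntegral_le_of_norm_le_const (μ := volume) (by simp) h
  unfold waveAverage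
  simpa using this

theorem measurable_waveSymbol_uncurry : Measurable fun p : ℝ × R3 => waveSymbol p.1 p.2 := by
  unfold waveSymbol
  fun_prop

theorem integrable_waveSymbol_prod (j : ℕ) {K : R3 → ℂ} (hK : Integrable K) :
    Integrable (fun p : ℝ × R3 => (waveSymbol p.1 p.2 : ℂ) * K p.2)
      ((volume.restrict (Set.Ioc (j : ℝ) (j + 1))).prod volume) := by
  have h1 : Integrable (fun p : ℝ × R3 => (p.1 : ℂ) * K p.2)
      ((volume.restrict (Set.Ioc (j : ℝ) (j + 1))).prod volume) := by
    refine Integrable.mul_prod (f := fun t : ℝ => (t : ℂ)) ?_ hK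
    exact (Complex.continuous_ofReal.integrableOn_Icc (a := (j : ℝ)) (b := j + 1)).mono_set
      Set.Ioc_subset_Icc_self
  refine h1.mono ((Complex.measurable_ofReal.comp
    measurable_waveSymbol_uncurry).aestronglyMeasurable.mul ?_) (Eventually.of_forall fun p => ?_)
  · exact hK.aestronglyMeasurable.comp_snd
  · rw [norm_mul, norm_mul, Complex.norm_real, Complex.norm_real]
    exact mul_le_mul_of_nonneg_right (abs_waveSymbol_le _ _) (norm_nonneg _)

theorem integral_waveSymbol_mul (j : ℕ) {K : R3 → ℂ} (hK : Integrable K) :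
    ∫ t in Set.Ioc (j : ℝ) (j + 1), ∫ ξ, (waveSymbol t ξ : ℂ) * K ξ =
      ∫ ξ, (waveAverage j ξ : ℂ) * K ξ := by
  rw [integral_integral_swap (integrable_waveSymbol_prod j hK)]
  congr 1
  ext ξ
  rw [integral_mul_const, waveAverage, integral_complex_ofReal]

theorem enorm_integral_sq_le {P : ℝ → ℂ} {μ : Measure ℝ} [IsProbabilityMeasure μ]
    (hP : AEStronglyMeasurable P μ) : ‖∫ t, P t ∂μ‖ₑ ^ 2 ≤ ∫⁻ t, ‖P t‖ₑ ^ 2 ∂μ := by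
  have h1 := eLpNorm_le_eLpNorm_of_exponent_le (p := 1) (q := 2) (by norm_num) hP
  have h2 := eLpNorm_nnreal_pow_eq_lintegral (f := P) (μ := μ) (p := 2) (by norm_num)
  rw [eLpNorm_one_eq_lintegral_enorm] at h1
  norm_cast at h2
  norm_num at h2
  rw [← h2]
  gcongr
  exact (enorm_integral_le_lintegral_enorm _).trans h1

theorem sum_lintegral_Ioc_le (N : ℕ) (h : ℝ → ℝ≥0∞) :
    ∑ j ∈ Finset.range N, ∫⁻ t in Set.Ioc (j : ℝ) (j + 1), h t ≤ ∫⁻ t, h t := by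
  rw [← lintegral_biUnion_finset]
  · exact setLIntegral_le_lintegral _ _
  · intro i _ j _ hij
    have := Set.pairwise_disjoint_Ioc_intCast ℝ (i := (i : ℤ)) (j := (j : ℤ)) (by exact_mod_cast hij)
    simpa [Function.onFun] using this
  · exact fun _ _ => measurableSet_Ioc

/-- As `φ` is real, the pairing `∫ h φ` is an `L₂` inner product, and Plancherel moves it to the
Fourier side. -/
theorem enorm_integral_le_bmoNorm (t : ℝ) (F : L2) (φ : 𝓢(R3, ℂ)) (hreal : ∀ x, conj (φ x) = φ x)
    (hH : MemH1 φ) (h1 : h1Norm φ ≤ 1) :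
    ‖∫ ξ, (waveSymbol t ξ : ℂ) * (F ξ * conj (𝓕 (φ : R3 → ℂ) ξ))‖ₑ ≤ bmoNorm (B t (𝓕⁻ F)) := by
  set h : L2 := B t (𝓕⁻ F) with hh
  have hint : Integrable fun x => h x * φ x :=
    MemLp.integrable_mul (Lp.memLp h) (φ.memLp 2)
  have e1 : ∫ x, h x * φ x = inner ℂ (φ.toLp 2) h := by
    rw [L2.inner_def]
    refine integral_congr_ae ?_
    filter_upwards [φ.coeFn_toLp 2] with x hx
    rw [hx, RCLike.inner_apply, hreal]
  have e2 : inner ℂ (φ.toLp 2) h =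
      inner ℂ ((𝓕 φ).toLp 2) ((memLp_waveSymbol_mul t F).toLp) := by
    rw [← Lp.inner_fourier_eq, SchwartzMap.toLp_fourier_eq, hh, B,
      FourierTransform.fourier_fourierInv_eq]
    congr 1
    exact MemLp.toLp_congr _ _ (by rw [FourierTransform.fourier_fourierInv_eq])
  have e3 : inner ℂ ((𝓕 φ).toLp 2) ((memLp_waveSymbol_mul t F).toLp) =
      ∫ ξ, (waveSymbol t ξ : ℂ) * (F ξ * conj (𝓕 (φ : R3 → ℂ) ξ)) := by
    rw [L2.inner_def]
    refine integral_congr_ae ?_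
    filter_upwards [(𝓕 φ).coeFn_toLp 2, (memLp_waveSymbol_mul t F).coeFn_toLp] with x hx hx'
    rw [hx, hx', RCLike.inner_apply, SchwartzMap.fourier_coe]
    ring
  rw [← e3, ← e2, ← e1]
  unfold bmoNorm
  exact le_iSup_of_le (φ : R3 → ℂ) (le_iSup_of_le hH (le_iSup_of_le h1
    (le_iSup_of_le hint le_rfl)))

/-- The intervals `(j, j + 1]` have length one, so the square of a time average is at most the time
integral of the square. They are disjoint, so different intervals may use different translates. -/
theorem sum_enorm_integral_sq_le (F : L2) (φ : 𝓢(R3, ℂ)) (hreal : ∀ x, conj (φ x) = φ x)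
    (hH : MemH1 φ) (h1 : h1Norm φ ≤ 1) (a : ℕ → R3) (N : ℕ) :
    ∑ j ∈ Finset.range N, ‖∫ ξ, (waveAverage j ξ : ℂ) *
      (F ξ * conj (𝓕 (fun x => φ (x - a j)) ξ))‖ₑ ^ 2 ≤
      ∫⁻ t : ℝ, bmoNorm (B t (𝓕⁻ F)) ^ 2 := by
  refine le_trans (Finset.sum_le_sum fun j _ => ?_) (sum_lintegral_Ioc_le N _)
  set φj : 𝓢(R3, ℂ) := SchwartzMap.compSubConstCLM ℂ (a j) φ with hφj
  have hK : Integrable fun ξ => F ξ * conj (𝓕 (fun x => φ (x - a j)) ξ) := by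
    have hm : MemLp (fun ξ => conj (𝓕 φj ξ)) 2 := ((𝓕 φj).memLp 2 volume).star
    exact MemLp.integrable_mul (Lp.memLp F) hm
  rw [← integral_waveSymbol_mul j hK]
  have : IsProbabilityMeasure (volume.restrict (Set.Ioc (j : ℝ) (j + 1))) := ⟨by simp⟩
  refine (enorm_integral_sq_le
    (integrable_waveSymbol_prod j hK).integral_prod_left.aestronglyMeasurable).trans ?_
  refine lintegral_mono fun t => ?_
  dsimp only
  gcongr
  exact enorm_integral_le_bmoNorm t F φj (fun x => hreal _) (hH.translate _)
    ((h1Norm_translate φ (a j)).trans_le h1)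

/-- The integral over `[0, N]` of the Fourier transform of the wave propagator applied to a
translate of `φ`, that jumps at integer times. -/
def dualSum (φ : R3 → ℂ) (a : ℕ → R3) (N : ℕ) (ξ : R3) : ℂ :=
  ∑ j ∈ Finset.range N, (waveAverage j ξ : ℂ) * 𝓕 (fun x => φ (x - a j)) ξ

theorem memLp_waveAverage_mul (j : ℕ) (φ : 𝓢(R3, ℂ)) :
    MemLp (fun ξ => (waveAverage j ξ : ℂ) * 𝓕 (φ : R3 → ℂ) ξ) 2 := by
  have h : MemLp (𝓕 (φ : R3 → ℂ)) 2 := (𝓕 φ).memLp 2 volume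
  refine h.of_le_mul (c := j + 1) ?_ (Eventually.of_forall fun ξ => ?_)
  · exact ((Complex.measurable_ofReal.comp
      (measurable_waveAverage j)).aestronglyMeasurable).mul h.1
  · rw [norm_mul, Complex.norm_real]
    exact mul_le_mul_of_nonneg_right (abs_waveAverage_le j ξ) (norm_nonneg _)

theorem memLp_dualSum (φ : 𝓢(R3, ℂ)) (a : ℕ → R3) (N : ℕ) : MemLp (dualSum φ a N) 2 :=
  memLp_finsetSum _ fun j _ => memLp_waveAverage_mul j (SchwartzMap.compSubConstCLM ℂ (a j) φ)

/-- The estimate is applied to the function whose Fourier transform is `dualSum` itself. Then `‖F‖²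
= ∑ I j`, and Cauchy–Schwarz gives `‖F‖² ≤ √N (∑ |I j|²)^(1/2) ≤ √N c ‖F‖`. -/
theorem lintegral_dualSum_sq_le {c : ℝ≥0} (hc : ∀ f : L2,
      (∫⁻ t : ℝ, bmoNorm (B t f) ^ 2) ^ (1 / 2 : ℝ) ≤ c * ‖f‖ₑ)
    (φ : 𝓢(R3, ℂ)) (hreal : ∀ x, conj (φ x) = φ x)
    (hH : MemH1 φ) (h1 : h1Norm φ ≤ 1) (a : ℕ → R3) (N : ℕ) :
    ∫⁻ ξ, ‖dualSum φ a N ξ‖ₑ ^ 2 ≤ ENNReal.ofReal (N * c ^ 2) := by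
  have hG := memLp_dualSum φ a N
  set F : L2 := hG.toLp with hF
  set I : ℕ → ℂ := fun j => ∫ ξ, (waveAverage j ξ : ℂ) *
      (F ξ * conj (𝓕 (fun x => φ (x - a j)) ξ)) with hI
  have hnorm : ‖(𝓕⁻ F : L2)‖ = ‖F‖ := by
    rw [← Lp.norm_fourier_eq, FourierTransform.fourier_fourierInv_eq]
  have b1 : ∑ j ∈ Finset.range N, ‖I j‖ ^ 2 ≤ (c * ‖F‖) ^ 2 := by
    have h2 := hc (𝓕⁻ F)
    have h3 : ∫⁻ t : ℝ, bmoNorm (B t (𝓕⁻ F)) ^ 2 ≤ (c * ‖(𝓕⁻ F : L2)‖ₑ) ^ 2 := by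
      have := pow_le_pow_left' h2 2
      rwa [← ENNReal.rpow_natCast, ← ENNReal.rpow_mul, Nat.cast_two,
        show (1 / 2 : ℝ) * 2 = 1 by norm_num, ENNReal.rpow_one] at this
    have h4 := (sum_enorm_integral_sq_le F φ hreal hH h1 a N).trans h3
    have h5 : (c * ‖(𝓕⁻ F : L2)‖ₑ) ^ 2 = ENNReal.ofReal ((c * ‖F‖) ^ 2) := by
      rw [← ofReal_norm, hnorm, ENNReal.ofReal_pow (by positivity),
        ENNReal.ofReal_mul (by positivity), ENNReal.ofReal_coe_nnreal]
    have h6 : ∑ j ∈ Finset.range N, ‖I j‖ₑ ^ 2 =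
        ENNReal.ofReal (∑ j ∈ Finset.range N, ‖I j‖ ^ 2) := by
      rw [ENNReal.ofReal_sum_of_nonneg (fun _ _ => by positivity)]
      refine Finset.sum_congr rfl fun j _ => ?_
      rw [ENNReal.ofReal_pow (norm_nonneg _), ofReal_norm]
    rw [h5, h6] at h4
    exact (ENNReal.ofReal_le_ofReal_iff (by positivity)).1 h4
  have b2 : ‖F‖ ^ 2 ≤ ∑ j ∈ Finset.range N, ‖I j‖ := by
    have h2 : ∑ j ∈ Finset.range N, I j = inner ℂ F F := by
      rw [L2.inner_def, hI]
      dsimp only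
      rw [← integral_finsetSum]
      · refine integral_congr_ae ?_
        filter_upwards [hG.coeFn_toLp] with ξ hξ
        rw [RCLike.inner_apply]
        -- Only the conjugated factor of the inner product is expanded into the sum.
        nth_rewrite 3 [hξ]
        rw [dualSum, map_sum, Finset.mul_sum]
        refine Finset.sum_congr rfl fun j _ => ?_
        rw [map_mul, Complex.conj_ofReal]
        ring
      · intro j _
        have hm : MemLp (fun ξ => conj ((waveAverage j ξ : ℂ) *
            𝓕 (fun x => φ (x - a j)) ξ)) 2 :=
          (memLp_waveAverage_mul j (SchwartzMap.compSubConstCLM ℂ (a j) φ)).star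
        refine (MemLp.integrable_mul (Lp.memLp F) hm).congr (Eventually.of_forall fun ξ => ?_)
        simp only [Pi.mul_apply, map_mul, Complex.conj_ofReal]
        ring
    rw [← inner_self_eq_norm_sq (𝕜 := ℂ), ← h2]
    exact (RCLike.re_le_norm _).trans (norm_sum_le _ _)
  have b3 : ‖F‖ ^ 2 ≤ N * c ^ 2 := by
    rcases eq_or_lt_of_le (norm_nonneg F) with h0 | h0
    · rw [← h0, zero_pow two_ne_zero]
      positivity
    · have h2 := sq_sum_le_card_mul_sum_sq (s := Finset.range N) (f := fun j => ‖I j‖)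
      rw [Finset.card_range] at h2
      have h3 : (‖F‖ ^ 2) ^ 2 ≤ N * (c * ‖F‖) ^ 2 := by
        calc (‖F‖ ^ 2) ^ 2 ≤ (∑ j ∈ Finset.range N, ‖I j‖) ^ 2 := by gcongr
          _ ≤ _ := h2.trans (by gcongr)
      refine le_of_mul_le_mul_right ?_ (pow_pos h0 2)
      linarith
  have b4 : ∫⁻ ξ, ‖dualSum φ a N ξ‖ₑ ^ 2 = ENNReal.ofReal (‖F‖ ^ 2) := by
    have h2 := eLpNorm_nnreal_pow_eq_lintegral (f := dualSum φ a N) (μ := volume) (p := 2)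
      (by norm_num)
    norm_cast at h2
    norm_num at h2
    rw [← h2, ENNReal.ofReal_pow (norm_nonneg _), ofReal_norm, Lp.enorm_def, hF,
      eLpNorm_congr_ae hG.coeFn_toLp]
  rw [b4]
  exact ENNReal.ofReal_le_ofReal b3

/-! ### The random walk along a light ray -/

/-- A step of the walk: a unit step along the light ray and a transversal step `±1`. -/
def step (b : Bool) : R3 := !₂[1, boolSign b, 0]

/-- The position of the walk after `j` steps. -/
def walkPos {N : ℕ} (ω : Fin N → Bool) (j : ℕ) : R3 :=
  ∑ l : Fin N, if (l : ℕ) < j then step (ω l) else 0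

theorem exp_inner_walkPos {N : ℕ} (ω : Fin N → Bool) (j : ℕ) (ξ : R3) :
    Complex.exp ((-2 * Real.pi * inner ℝ (walkPos ω j) ξ : ℝ) * Complex.I) =
      walkProd (circleStep (-(2 * Real.pi * ξ 0)) (2 * Real.pi * ξ 1)) ω j := by
  rw [walkPos, sum_inner, Finset.mul_sum, Complex.ofReal_sum, Finset.sum_mul, Complex.exp_sum,
    walkProd]
  refine Finset.prod_congr rfl fun l _ => ?_
  split_ifs with h
  · rw [circleStep]
    congr 3
    simp [step, PiLp.inner_apply, Fin.sum_univ_three]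
    ring
  · simp

theorem circleStep_sub (s A y : ℝ) :
    circleStep (s - A) y = fun b => Complex.exp (s * Complex.I) * circleStep (-A) y b := by
  ext b
  rw [circleStep, circleStep, ← Complex.exp_add]
  congr 1
  push_cast
  ring

/-- The weight that multiplies the squares of walk sums in the square of `dualSum`. -/
def weight (φ : R3 → ℂ) (ξ : R3) : ℝ :=
  ‖𝓕 φ ξ‖ ^ 2 * (Real.sin (2 * Real.pi * ‖ξ‖ / 2) / (2 * Real.pi * ‖ξ‖) ^ 2) ^ 2

theorem weight_nonneg (φ : R3 → ℂ) (ξ : R3) : 0 ≤ weight φ ξ := by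
  unfold weight
  positivity

/-- The multiplicative walk that resonates with the light ray. -/
def resonantStep (ξ : R3) : Bool → ℂ :=
  circleStep (2 * Real.pi * ‖ξ‖ - 2 * Real.pi * ξ 0) (2 * Real.pi * ξ 1)

/-- The multiplicative walk that comes from the backward light ray. -/
def nonresonantStep (ξ : R3) : Bool → ℂ :=
  circleStep (-(2 * Real.pi * ‖ξ‖) - 2 * Real.pi * ξ 0) (2 * Real.pi * ξ 1)

/-- The difference of cosines in `waveAverage` is `2 sin((j + 1/2) r) sin(r/2)`. Writing the first
sine through exponentials, the factors `exp(±ijr)` are absorbed into the steps of the walk, one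
factor `exp(±ir)` per step. -/
theorem dualSum_walkPos (φ : R3 → ℂ) {N : ℕ} (ω : Fin N → Bool) (ξ : R3) :
    dualSum φ (walkPos ω) N ξ = 𝓕 φ ξ *
      ((Real.sin (2 * Real.pi * ‖ξ‖ / 2) / (2 * Real.pi * ‖ξ‖) ^ 2 : ℝ) : ℂ) * -Complex.I *
      (Complex.exp ((2 * Real.pi * ‖ξ‖ / 2 : ℝ) * Complex.I) * walkSum (resonantStep ξ) ω -
       Complex.exp ((-(2 * Real.pi * ‖ξ‖ / 2) : ℝ) * Complex.I) *
        walkSum (nonresonantStep ξ) ω) := by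
  unfold dualSum walkSum
  set r := 2 * Real.pi * ‖ξ‖ with hr
  rw [mul_sub, Finset.mul_sum, Finset.mul_sum, Finset.mul_sum, Finset.mul_sum,
    ← Finset.sum_sub_distrib]
  refine Finset.sum_congr rfl fun j hj => ?_
  have hjN : j ≤ N := (Finset.mem_range.1 hj).le
  rw [fourier_translate, exp_inner_walkPos, waveAverage_eq, ← hr, resonantStep, nonresonantStep,
    ← hr, circleStep_sub, circleStep_sub,
    walkProd_smul _ _ _ hjN, walkProd_smul _ _ _ hjN, ← Complex.exp_nat_mul, ← Complex.exp_nat_mul]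
  have h1 : Real.cos (j * r) - Real.cos ((j + 1) * r) =
      2 * Real.sin (j * r + r / 2) * Real.sin (r / 2) := by
    rw [Real.cos_sub_cos, show (j * r + (j + 1) * r) / 2 = j * r + r / 2 by ring,
      show (j * r - (j + 1) * r) / 2 = -(r / 2) by ring, Real.sin_neg]
    ring
  have h2 : ((2 * Real.sin (j * r + r / 2) : ℝ) : ℂ) = -Complex.I *
      (Complex.exp ((r / 2 : ℝ) * Complex.I) * Complex.exp (j * (r * Complex.I)) -
        Complex.exp ((-(r / 2) : ℝ) * Complex.I) *
          Complex.exp (j * ((-r : ℝ) * Complex.I))) := by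
    push_cast
    rw [Complex.sin, ← Complex.exp_add, ← Complex.exp_add]
    ring_nf
  rw [h1, mul_div_assoc, Complex.ofReal_mul, h2]
  ring

theorem weight_mul_le (φ : R3 → ℂ) {N : ℕ} (ω : Fin N → Bool) (ξ : R3) :
    weight φ ξ * (‖walkSum (resonantStep ξ) ω‖ ^ 2 / 2 - ‖walkSum (nonresonantStep ξ) ω‖ ^ 2) ≤
      ‖dualSum φ (walkPos ω) N ξ‖ ^ 2 := by
  rw [dualSum_walkPos, norm_mul, norm_mul, norm_mul, norm_neg, Complex.norm_I, mul_one,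
    Complex.norm_real, mul_pow, mul_pow, Real.norm_eq_abs, sq_abs, weight]
  refine mul_le_mul_of_nonneg_left ?_ (by positivity)
  set X := Complex.exp ((2 * Real.pi * ‖ξ‖ / 2 : ℝ) * Complex.I) * walkSum (resonantStep ξ) ω
    with hX
  set Y := Complex.exp ((-(2 * Real.pi * ‖ξ‖ / 2) : ℝ) * Complex.I) *
        walkSum (nonresonantStep ξ) ω with hY
  have hX' : ‖walkSum (resonantStep ξ) ω‖ = ‖X‖ := by
    rw [hX, norm_mul, Complex.norm_exp_ofReal_mul_I, one_mul]
  have hY' : ‖walkSum (nonresonantStep ξ) ω‖ = ‖Y‖ := by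
    rw [hY, norm_mul, Complex.norm_exp_ofReal_mul_I, one_mul]
  rw [hX', hY']
  have h1 : ‖X‖ ≤ ‖X - Y‖ + ‖Y‖ := by simpa using norm_add_le (X - Y) Y
  have h2 : ‖X‖ ^ 2 ≤ (‖X - Y‖ + ‖Y‖) ^ 2 := by gcongr
  -- This is `|X|² ≤ 2|X - Y|² + 2|Y|²`, halved.
  nlinarith [sq_nonneg (‖X - Y‖ - ‖Y‖)]

theorem weight_mul_walkSq_le (φ : R3 → ℂ) (N : ℕ) (ξ : R3) :
    weight φ ξ * (walkSq (resonantStep ξ) N / 2 - walkSq (nonresonantStep ξ) N) ≤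
      (∑ ω : Fin N → Bool, ‖dualSum φ (walkPos ω) N ξ‖ ^ 2) / 2 ^ N := by
  have h := Finset.sum_le_sum fun (ω : Fin N → Bool) (_ : ω ∈ Finset.univ) => weight_mul_le φ ω ξ
  rw [← Finset.mul_sum, Finset.sum_sub_distrib, ← Finset.sum_div] at h
  rw [le_div_iff₀ (by positivity)]
  refine le_trans (le_of_eq ?_) h
  unfold walkSq
  field_simp

/-! ### Divergence of the limit -/

theorem continuous_walkSq {u : R3 → Bool → ℂ} (hu : ∀ b, Continuous fun ξ => u ξ b) (N : ℕ) :
    Continuous fun ξ => walkSq (u ξ) N := by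
  unfold walkSq walkSum walkProd
  refine Continuous.div_const (continuous_finsetSum _ fun ω _ => Continuous.pow
    (Continuous.norm (continuous_finsetSum _ fun j _ => continuous_finsetProd _ fun l _ => ?_))
    2) _
  split_ifs
  · exact hu _
  · exact continuous_const

theorem continuous_resonantStep (b : Bool) : Continuous fun ξ => resonantStep ξ b := by
  unfold resonantStep circleStep
  fun_prop

theorem continuous_nonresonantStep (b : Bool) : Continuous fun ξ => nonresonantStep ξ b := by
  unfold nonresonantStep circleStep
  fun_prop

theorem continuous_fourier_schwartz (φ : 𝓢(R3, ℂ)) : Continuous (𝓕 (φ : R3 → ℂ)) :=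
  (𝓕 φ).continuous

theorem measurable_weight (φ : 𝓢(R3, ℂ)) : Measurable (weight φ) := by
  have := (continuous_fourier_schwartz φ).measurable
  unfold weight
  fun_prop

/-- At `baseFrequency` the angular frequency has norm one, so the weight is `|𝓕 φ|² sin²(1/2) > 0`;
continuity does the rest. -/
theorem exists_weight_ge {φ : 𝓢(R3, ℂ)} (hφ : 𝓕 (φ : R3 → ℂ) baseFrequency ≠ 0) :
    ∃ ε > 0, ∃ δ > 0, ∀ ξ, ‖ξ - baseFrequency‖ < δ → ε ≤ weight φ ξ := by
  have hr : 2 * Real.pi * ‖baseFrequency‖ = 1 := by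
    rw [norm_baseFrequency]
    field_simp
  have hpos : 0 < weight φ baseFrequency := by
    have : 0 < Real.sin (1 / 2) :=
      Real.sin_pos_of_pos_of_lt_pi (by norm_num) (by linarith [Real.pi_gt_three])
    unfold weight
    rw [hr]
    positivity
  have hcont : ContinuousAt (weight φ) baseFrequency := by
    have h1 : ContinuousAt (𝓕 (φ : R3 → ℂ)) baseFrequency :=
      (continuous_fourier_schwartz φ).continuousAt
    unfold weight
    refine (h1.norm.pow 2).mul (ContinuousAt.pow (ContinuousAt.div (by fun_prop) (by fun_prop) ?_) 2)
    rw [hr]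
    norm_num
  obtain ⟨δ, hδ, h⟩ := Metric.eventually_nhds_iff.1
    (hcont.eventually (lt_mem_nhds (half_lt_self hpos)))
  exact ⟨_, half_pos hpos, δ, hδ, fun ξ hξ => (h (by rwa [dist_eq_norm])).le⟩

/-- The bound for `dualSum` does not depend on the path, so it survives averaging over all `2 ^ N`
walks. -/
theorem lintegral_walkSq_le {c : ℝ≥0} (hc : ∀ f : L2,
      (∫⁻ t : ℝ, bmoNorm (B t f) ^ 2) ^ (1 / 2 : ℝ) ≤ c * ‖f‖ₑ)
    (φ : 𝓢(R3, ℂ)) (hreal : ∀ x, conj (φ x) = φ x)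
    (hH : MemH1 φ) (h1 : h1Norm φ ≤ 1) {N : ℕ} (hN : 0 < N) :
    ∫⁻ ξ, ENNReal.ofReal (weight φ ξ *
      ((walkSq (resonantStep ξ) N / 2 - walkSq (nonresonantStep ξ) N) / N)) ≤
      ENNReal.ofReal (c ^ 2) := by
  have hN' : (0 : ℝ) < N := by exact_mod_cast hN
  have e : ∀ ξ, ENNReal.ofReal (weight φ ξ *
      ((walkSq (resonantStep ξ) N / 2 - walkSq (nonresonantStep ξ) N) / N)) ≤
      ENNReal.ofReal ((2 ^ N * N : ℝ)⁻¹) *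
        ∑ ω : Fin N → Bool, ‖dualSum φ (walkPos ω) N ξ‖ₑ ^ 2 := by
    intro ξ
    have h2 : ∑ ω : Fin N → Bool, ‖dualSum φ (walkPos ω) N ξ‖ₑ ^ 2 =
        ENNReal.ofReal (∑ ω : Fin N → Bool, ‖dualSum φ (walkPos ω) N ξ‖ ^ 2) := by
      rw [ENNReal.ofReal_sum_of_nonneg (fun _ _ => by positivity)]
      refine Finset.sum_congr rfl fun j _ => ?_
      rw [ENNReal.ofReal_pow (norm_nonneg _), ofReal_norm]
    rw [h2, ← ENNReal.ofReal_mul (by positivity)]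
    refine ENNReal.ofReal_le_ofReal ?_
    rw [← mul_div_assoc, div_le_iff₀ hN']
    refine (weight_mul_walkSq_le φ N ξ).trans (le_of_eq ?_)
    field_simp
  refine (lintegral_mono e).trans ?_
  rw [lintegral_const_mul' _ _ ENNReal.ofReal_ne_top, lintegral_finsetSum']
  · calc _ ≤ ENNReal.ofReal ((2 ^ N * N : ℝ)⁻¹) *
          ∑ ω : Fin N → Bool, ENNReal.ofReal (N * c ^ 2) := by
          gcongr
          exact lintegral_dualSum_sq_le hc φ hreal hH h1 _ N
      _ = ENNReal.ofReal (c ^ 2) := by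
        rw [← ENNReal.ofReal_sum_of_nonneg (fun _ _ => by positivity),
          ← ENNReal.ofReal_mul (by positivity)]
        congr 1
        simp
        field_simp
  · exact fun ω _ => (memLp_dualSum φ _ N).1.enorm.pow_const 2

/-- Fatou's lemma; the restriction to `R` is needed because the limit is only controlled there. -/
theorem lintegral_of_tendsto_walkSq_le {c : ℝ≥0} (hc : ∀ f : L2,
      (∫⁻ t : ℝ, bmoNorm (B t f) ^ 2) ^ (1 / 2 : ℝ) ≤ c * ‖f‖ₑ)
    (φ : 𝓢(R3, ℂ)) (hreal : ∀ x, conj (φ x) = φ x)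
    (hH : MemH1 φ) (h1 : h1Norm φ ≤ 1) {R : Set R3} (hR : MeasurableSet R) {h : R3 → ℝ≥0∞}
    (hh : ∀ ξ ∈ R, h ξ ≤ liminf (fun N : ℕ => ENNReal.ofReal (weight φ ξ *
      ((walkSq (resonantStep ξ) N / 2 - walkSq (nonresonantStep ξ) N) / N))) atTop) :
    ∫⁻ ξ in R, h ξ ≤ ENNReal.ofReal (c ^ 2) := by
  refine (setLIntegral_mono' hR hh).trans ((lintegral_liminf_le fun N => ?_).trans ?_)
  · exact ((measurable_weight φ).mul
      ((((continuous_walkSq continuous_resonantStep N).div_const 2).sub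
        (continuous_walkSq continuous_nonresonantStep N)).div_const _).measurable).ennreal_ofReal
  · refine liminf_le_of_le (by isBoundedDefault) fun b hb => ?_
    obtain ⟨N, hN, hN'⟩ := (hb.and (eventually_gt_atTop 0)).exists
    exact hN.trans ((setLIntegral_le_lintegral _ _).trans
      (lintegral_walkSq_le hc φ hreal hH h1 hN'))

/-- The box with opposite corners `a` and `b`. -/
def box (a b : Fin 3 → ℝ) : Set R3 := {ξ | ∀ i, ξ i ∈ Set.Ioo (a i) (b i)}

theorem box_eq_preimage (a b : Fin 3 → ℝ) :
    box a b = (MeasurableEquiv.toLp 2 (Fin 3 → ℝ)).symm ⁻¹'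
      (Set.univ.pi fun i => Set.Ioo (a i) (b i)) := by
  ext ξ
  simp [box]

theorem measurableSet_box (a b : Fin 3 → ℝ) : MeasurableSet (box a b) := by
  rw [box_eq_preimage]
  exact (MeasurableEquiv.measurable _) (MeasurableSet.univ_pi fun _ => measurableSet_Ioo)

theorem volume_box (a b : Fin 3 → ℝ) :
    volume (box a b) = ∏ i, ENNReal.ofReal (b i - a i) := by
  rw [box_eq_preimage, (EuclideanSpace.volume_preserving_symm_measurableEquiv_toLp
    (Fin 3)).measure_preimage_equiv, Real.volume_pi_Ioo]

/-- Boxes in the cone `0 < ξ 2 < ξ 1`, at dyadic distances from the first axis. -/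
def dyadicBox (η : ℝ) (k : ℕ) : Set R3 :=
  box ![1 / (2 * Real.pi) - η, η * (1 / 2) ^ (k + 1), 0]
    ![1 / (2 * Real.pi) + η, η * (1 / 2) ^ k, η * (1 / 2) ^ (k + 1)]

theorem mem_dyadicBox {η : ℝ} {k : ℕ} {ξ : R3} : ξ ∈ dyadicBox η k ↔
    (1 / (2 * Real.pi) - η < ξ 0 ∧ ξ 0 < 1 / (2 * Real.pi) + η) ∧
    (η * (1 / 2) ^ (k + 1) < ξ 1 ∧ ξ 1 < η * (1 / 2) ^ k) ∧
    (0 < ξ 2 ∧ ξ 2 < η * (1 / 2) ^ (k + 1)) := by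
  simp [dyadicBox, box, Fin.forall_fin_succ]

theorem measurableSet_dyadicBox (η : ℝ) (k : ℕ) : MeasurableSet (dyadicBox η k) :=
  measurableSet_box _ _

theorem pairwise_disjoint_dyadicBox {η : ℝ} (hη : 0 < η) :
    Pairwise (Function.onFun Disjoint (dyadicBox η)) := by
  have key : ∀ i j : ℕ, i < j → Disjoint (dyadicBox η i) (dyadicBox η j) := by
    intro i j hij
    refine Set.disjoint_left.2 fun ξ h1 h2 => ?_
    have h3 : η * (1 / 2) ^ j ≤ η * (1 / 2) ^ (i + 1) := by
      gcongr ?_ * ?_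
      exact pow_le_pow_of_le_one (by norm_num) (by norm_num) hij
    have h4 := (mem_dyadicBox.1 h1).2.1.1
    have h5 := (mem_dyadicBox.1 h2).2.1.2
    linarith
  intro i j hij
  rcases lt_or_gt_of_ne hij with h | h
  · exact key i j h
  · exact (key j i h).symm

/-- The two short sides are `η / 2 ^ (k + 1)` and the integrand is at least `κ / (η / 2 ^ k)²`, so
the powers of two cancel and every box contributes the same amount. -/
theorem lintegral_dyadicBox_ge {η κ : ℝ} (hη : 0 < η) (hκ : 0 < κ) (k : ℕ) :
    ENNReal.ofReal (κ * η / 2) ≤ ∫⁻ ξ in dyadicBox η k, ENNReal.ofReal (κ / ξ 1 ^ 2) := by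
  have hm : MeasurableSet (dyadicBox η k) := measurableSet_dyadicBox η k
  have h1 : ∀ ξ ∈ dyadicBox η k,
      ENNReal.ofReal (κ / (η * (1 / 2) ^ k) ^ 2) ≤ ENNReal.ofReal (κ / ξ 1 ^ 2) := by
    intro ξ hξ
    obtain ⟨_, h2, _⟩ := mem_dyadicBox.1 hξ
    have h3 : 0 < ξ 1 := lt_trans (by positivity) h2.1
    refine ENNReal.ofReal_le_ofReal ?_
    gcongr
    exact h2.2.le
  refine le_trans (le_of_eq ?_) (setLIntegral_mono' hm h1)
  rw [setLIntegral_const, dyadicBox, volume_box, Fin.prod_univ_three]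
  have h2 : η * (1 / 2) ^ k - η * (1 / 2) ^ (k + 1) = η * (1 / 2) ^ (k + 1) := by ring
  simp only [Matrix.cons_val]
  rw [h2, ← ENNReal.ofReal_mul (by linarith), ← ENNReal.ofReal_mul (by
    rw [add_sub_sub_cancel]; positivity), ← ENNReal.ofReal_mul (by positivity)]
  congr 1
  rw [pow_succ]
  field_simp
  ring

theorem lintegral_iUnion_dyadicBox {η κ : ℝ} (hη : 0 < η) (hκ : 0 < κ) :
    ∫⁻ ξ in ⋃ k, dyadicBox η k, ENNReal.ofReal (κ / ξ 1 ^ 2) = ∞ := by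
  rw [lintegral_iUnion (measurableSet_dyadicBox η) (pairwise_disjoint_dyadicBox hη), eq_top_iff,
    ← ENNReal.tsum_const_eq_top_of_ne_zero (α := ℕ) (c := ENNReal.ofReal (κ * η / 2))
      (by simpa using by positivity)]
  exact ENNReal.tsum_le_tsum fun k => lintegral_dyadicBox_ge hη hκ k

/-- From `(r - a)(r + a) = y² + z² ≤ 2y²` and `r + a ≥ 1` the first bound follows; the cone
condition `z ≤ y` enters here. The sum `r + a` is close to `2`, between `π / 2` and `3π / 2`. -/
theorem norm_sub_coord_bounds {a y z r : ℝ} (a1 : 0.9 ≤ a) (a2 : a ≤ 1.1) (y0 : 0 < y)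
    (y1 : y ≤ 0.1) (z0 : 0 < z) (z1 : z ≤ y) (r0 : 0 ≤ r) (hr : r ^ 2 = a ^ 2 + y ^ 2 + z ^ 2) :
    |r - a| ≤ 2 * y ^ 2 ∧ Real.cos (r + a) ≤ 0 := by
  have hz : z ^ 2 ≤ y ^ 2 := by gcongr
  have ha : a ^ 2 ≤ r ^ 2 := by linarith [sq_nonneg y, sq_nonneg z]
  have ra : a ≤ r := (sq_le_sq₀ (by norm_num at a1; linarith) r0).1 ha
  have h1 : (r - a) * (r + a) ≤ 2 * y ^ 2 := by linarith
  have h2 : r - a ≤ (r - a) * (r + a) :=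
    le_mul_of_one_le_right (by linarith) (by norm_num at *; linarith)
  have h3 : r - a ≤ 2 * y ^ 2 := h2.trans h1
  have h4 : y ^ 2 ≤ 0.1 ^ 2 := by gcongr
  have := Real.pi_gt_three
  have := Real.pi_lt_d2
  refine ⟨by rwa [abs_of_nonneg (by linarith)], Real.cos_nonpos_of_pi_div_two_le_of_le ?_ ?_⟩ <;>
  norm_num at * <;> linarith

theorem exists_tendsto_of_mem_dyadicBox {η : ℝ} (hη : 0 < η) (hη' : η ≤ 1 / 100) {k : ℕ} {ξ : R3}
    (hξ : ξ ∈ dyadicBox η k) :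
    ∃ L, 1 / (144 * (2 * Real.pi * ξ 1) ^ 2) ≤ L ∧ Tendsto (fun N : ℕ =>
      (walkSq (resonantStep ξ) N / 2 - walkSq (nonresonantStep ξ) N) / N) atTop (𝓝 L) := by
  obtain ⟨⟨h1, h2⟩, ⟨h3, h4⟩, h5, h6⟩ := mem_dyadicBox.1 hξ
  have hpi := Real.pi_gt_three
  have hpi' := Real.pi_lt_four
  have hpi2 : 2 * Real.pi * (1 / (2 * Real.pi)) = 1 := by field_simp
  have hy0 : 0 < ξ 1 := lt_trans (by positivity) h3
  have hy1 : ξ 1 < η := h4.trans_le (mul_le_of_le_one_right hη.le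
    (pow_le_one₀ (by norm_num) (by norm_num)))
  have hz : ξ 2 < ξ 1 := h6.trans h3
  -- This puts `a` within `0.08` of `1` and keeps `y` below `0.08`.
  have hη8 : 2 * Real.pi * η ≤ 2 * 4 * (1 / 100) := by gcongr
  set a := 2 * Real.pi * ξ 0 with ha
  set y := 2 * Real.pi * ξ 1 with hy
  set z := 2 * Real.pi * ξ 2 with hz'
  set r := 2 * Real.pi * ‖ξ‖ with hr
  have a1 : 0.9 ≤ a := by
    have := mul_lt_mul_of_pos_left h1 (by positivity : 0 < 2 * Real.pi)
    rw [mul_sub, hpi2] at this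
    norm_num at hη8 ⊢
    linarith
  have a2 : a ≤ 1.1 := by
    have := mul_lt_mul_of_pos_left h2 (by positivity : 0 < 2 * Real.pi)
    rw [mul_add, hpi2] at this
    norm_num at hη8 ⊢
    linarith
  have y0 : 0 < y := by positivity
  have y1 : y ≤ 0.1 := by
    have := mul_lt_mul_of_pos_left hy1 (by positivity : 0 < 2 * Real.pi)
    norm_num at hη8 ⊢
    linarith
  have z0 : 0 < z := by positivity
  have z1 : z ≤ y := by rw [hy, hz']; gcongr
  have r2 : r ^ 2 = a ^ 2 + y ^ 2 + z ^ 2 := by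
    rw [hr, mul_pow, EuclideanSpace.real_norm_sq_eq, Fin.sum_univ_three]
    ring
  have r0 : 0 ≤ r := by positivity
  obtain ⟨hra, hcos⟩ := norm_sub_coord_bounds a1 a2 y0 y1 z0 z1 r0 r2
  exact exists_tendsto_walkSq_sub y0 (by norm_num at y1; linarith) hra hcos

end WaveBMO

end

open WaveBMO in
/-- There is no constant `c` such that `(∫ ‖B t f‖_BMO ^ 2 dt) ^ (1 / 2) ≤ c ‖f‖₂` for all `f`
in `L₂(ℝ³)`. -/
theorem theorem3 :
    ¬ ∃ c : ℝ≥0, ∀ f : WaveBMO.L2,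
      (∫⁻ t : ℝ, WaveBMO.bmoNorm (WaveBMO.B t f) ^ 2) ^ (1 / 2 : ℝ) ≤ c * ‖f‖ₑ := by
  rintro ⟨c, hc⟩
  obtain ⟨φ, hreal, hH, h1, hφ⟩ := exists_schwartz_memH1
  obtain ⟨ε, hε, δ, hδ, hW⟩ := exists_weight_ge hφ
  -- The bound `1 / 100` serves the phase estimates; `δ / 2` keeps the boxes, which lie within `2η`
  -- of `baseFrequency`, where the weight is at least `ε`.
  set η := min (1 / 100) (δ / 2) with hη
  have hη0 : 0 < η := by positivity
  set κ := ε / (144 * (2 * Real.pi) ^ 2) with hκ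
  have hκ0 : 0 < κ := by positivity
  refine absurd (lintegral_of_tendsto_walkSq_le hc φ hreal hH h1
    (R := ⋃ k, dyadicBox η k) (MeasurableSet.iUnion (measurableSet_dyadicBox η))
    (h := fun ξ => ENNReal.ofReal (κ / ξ 1 ^ 2)) fun ξ hξ => ?_) ?_
  · obtain ⟨k, hk⟩ := Set.mem_iUnion.1 hξ
    obtain ⟨L, hL, hlim⟩ := exists_tendsto_of_mem_dyadicBox hη0 (min_le_left _ _) hk
    rw [(ENNReal.tendsto_ofReal (hlim.const_mul (weight φ ξ))).liminf_eq]
    refine ENNReal.ofReal_le_ofReal ?_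
    have hdist : ‖ξ - baseFrequency‖ < δ := by
      obtain ⟨⟨b1, b2⟩, ⟨b3, b4⟩, b5, b6⟩ := mem_dyadicBox.1 hk
      have p1 : (1 / 2 : ℝ) ^ k ≤ 1 := pow_le_one₀ (by norm_num) (by norm_num)
      have p2 : η * (1 / 2) ^ k ≤ η := mul_le_of_le_one_right hη0.le p1
      have p3 : 0 < η * (1 / 2) ^ (k + 1) := by positivity
      have p4 : η * (1 / 2) ^ (k + 1) ≤ η :=
        mul_le_of_le_one_right hη0.le (pow_le_one₀ (by norm_num) (by norm_num))
      have q : ‖ξ - baseFrequency‖ ^ 2 < (2 * η) ^ 2 := by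
        rw [EuclideanSpace.real_norm_sq_eq, Fin.sum_univ_three]
        have c0 : (ξ - baseFrequency) 0 = ξ 0 - 1 / (2 * Real.pi) := rfl
        have c1 : (ξ - baseFrequency) 1 = ξ 1 := sub_zero (ξ 1)
        have c2 : (ξ - baseFrequency) 2 = ξ 2 := sub_zero (ξ 2)
        rw [c0, c1, c2]
        have s0 : (ξ 0 - 1 / (2 * Real.pi)) ^ 2 ≤ η ^ 2 :=
          sq_le_sq' (by linarith) (by linarith)
        have s1 : ξ 1 ^ 2 ≤ η ^ 2 := sq_le_sq' (by linarith) (by linarith)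
        have s2 : ξ 2 ^ 2 ≤ η ^ 2 := sq_le_sq' (by linarith) (by linarith)
        nlinarith [pow_pos hη0 2]
      have q2 := lt_of_pow_lt_pow_left₀ 2 (by positivity) q
      linarith [min_le_right (1 / 100) (δ / 2)]
    calc κ / ξ 1 ^ 2 = ε * (1 / (144 * (2 * Real.pi * ξ 1) ^ 2)) := by
          rw [hκ, mul_pow]
          field_simp
      _ ≤ weight φ ξ * L :=
          mul_le_mul (hW ξ hdist) hL (by positivity) (weight_nonneg _ _)
  · rw [lintegral_iUnion_dyadicBox hη0 hκ0]
    exact not_le.2 ENNReal.ofReal_lt_top
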